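/- Let $\kappa$ be a regular uncountable cardinal with $\kappa>2^{\aleph_0}$, let $I$ be a ${<}\kappa$-complete ideal on $\kappa$ (that is, $I$ is closed under unions of fewer than $\kappa$ many of its members; normality of $I$ is not assumed), and call $A\subseteq\kappa$ positive if $A\notin I$. Suppose that the Boolean algebra $B_I=\mathcal P(\kappa)/I$ is proper, i.e. that the forcing notion $P$ of nonzero elements of $B_I$, with smaller elements being stronger, has the following property: for all sufficiently large regular cardinals $\chi$, for every countable elementary submodel $N$ of $(H(\chi),\in)$ with $P\in N$, and for every $p\in P\cap N$, there is an $(N,P)$-generic $q\le p$, i.e. a $q\le p$ in $P$ such that for every predense $D\subseteq P$ with $D\in N$ the set $D\cap N$ is predense below $q$. (Here $H(\chi)$ is the family of sets whose transitive closure has cardinality less than $\chi$.) Consider the Banach–Mazur game $\mathrm{BM}_{\notin I,\emptyset}(I)$ of length $\omega$ between the players empty and nonempty: put $S_{-1}=\kappa$; at stage $n\in\omega$, empty first chooses a positive $X_n\subseteq S_{n-1}$, and then nonempty chooses a positive $S_n\subseteq X_n$. Empty wins the run iff $\bigcap_{n\in\omega}S_n\in I$. Then empty has no winning strategy in $\mathrm{BM}_{\notin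 I,\emptyset}(I)$; that is, $\mathfrak a(\mathrm{BM}_{\notin I,\emptyset}(I))$ holds. -/

import Mathlib

universe u

open Cardinal

/-! ### The Boolean algebra `𝒫(α)/I` -/

/-- Two sets are identified modulo the ideal `I` if their symmetric difference lies in `I`. -/
def idealSetoid {α : Type u} (I : Order.Ideal (Set α)) : Setoid (Set α) where
  r A B := A \ B ∈ I ∧ B \ A ∈ I
  iseqv :=
    { refl := fun A => by
        have h : (∅ : Set α) ∈ I := I.bot_mem
        simpa using h
      symm := fun h => ⟨h.2, h.1⟩
      trans := fun {A B C} h k =>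
        ⟨I.lower (show A \ C ≤ A \ B ∪ B \ C from fun x hx => by
            by_cases hB : x ∈ B
            · exact Or.inr ⟨hB, hx.2⟩
            · exact Or.inl ⟨hx.1, hB⟩) (I.sup_mem h.1 k.1),
          I.lower (show C \ A ≤ C \ B ∪ B \ A from fun x hx => by
            by_cases hB : x ∈ B
            · exact Or.inr ⟨hB, hx.2⟩
            · exact Or.inl ⟨hx.1, hB⟩) (I.sup_mem k.2 h.2)⟩ }

/-- The quotient `𝒫(α)/I`. -/
def PowMod {α : Type u} (I : Order.Ideal (Set α)) : Type u := Quotient (idealSetoid I)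

namespace PowMod

variable {α : Type u} {I : Order.Ideal (Set α)}

/-- The class of a set modulo `I`. -/
def mk (I : Order.Ideal (Set α)) (A : Set α) : PowMod I := Quotient.mk (idealSetoid I) A

theorem mk_eq_mk {A B : Set α} : mk I A = mk I B ↔ A \ B ∈ I ∧ B \ A ∈ I :=
  Quotient.eq (r := idealSetoid I)

theorem mk_surjective : Function.Surjective (mk I) := Quotient.exists_rep

/-- `[A] ≤ [B]` iff `A \ B ∈ I`. -/
instance instLE : LE (PowMod I) where
  le := Quotient.lift₂ (fun A B : Set α => A \ B ∈ I) (by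
    intro A B A' B' hA hB
    refine propext ⟨fun h => I.lower (show A' \ B' ≤ A' \ A ∪ (A \ B ∪ B \ B') from ?_)
        (I.sup_mem hA.2 (I.sup_mem h hB.1)),
      fun h => I.lower (show A \ B ≤ A \ A' ∪ (A' \ B' ∪ B' \ B) from ?_)
        (I.sup_mem hA.1 (I.sup_mem h hB.2))⟩
    · intro x hx
      by_cases h1 : x ∈ A <;> by_cases h2 : x ∈ B <;> simp_all
    · intro x hx
      by_cases h1 : x ∈ A' <;> by_cases h2 : x ∈ B' <;> simp_all)

theorem mk_le_mk {A B : Set α} : mk I A ≤ mk I B ↔ A \ B ∈ I := Iff.rfl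

instance instPartialOrder : PartialOrder (PowMod I) where
  le_refl a := by
    obtain ⟨A, rfl⟩ := mk_surjective a
    have h : (∅ : Set α) ∈ I := I.bot_mem
    simpa [mk_le_mk] using h
  le_trans a b c hab hbc := by
    obtain ⟨A, rfl⟩ := mk_surjective a
    obtain ⟨B, rfl⟩ := mk_surjective b
    obtain ⟨C, rfl⟩ := mk_surjective c
    rw [mk_le_mk] at *
    refine I.lower (show A \ C ≤ A \ B ∪ B \ C from ?_) (I.sup_mem hab hbc)
    intro x hx
    by_cases h : x ∈ B <;> simp_all
  le_antisymm a b hab hba := by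
    obtain ⟨A, rfl⟩ := mk_surjective a
    obtain ⟨B, rfl⟩ := mk_surjective b
    exact mk_eq_mk.2 ⟨hab, hba⟩

theorem mk_mono {A B : Set α} (h : A ⊆ B) : mk I A ≤ mk I B := by
  rw [mk_le_mk, Set.sdiff_eq_empty.2 h]
  exact I.bot_mem

theorem mk_inter_le_of {A B C : Set α} (hB : mk I A ≤ mk I B) (hC : mk I A ≤ mk I C) :
    mk I A ≤ mk I (B ∩ C) := by
  rw [mk_le_mk, Set.sdiff_inter]
  exact I.sup_mem hB hC

theorem mk_union_le_of {A B C : Set α} (hA : mk I A ≤ mk I C) (hB : mk I B ≤ mk I C) :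
    mk I (A ∪ B) ≤ mk I C := by
  rw [mk_le_mk, Set.union_sdiff_distrib]
  exact I.sup_mem hA hB

theorem compl_congr {A B : Set α} (h : mk I A = mk I B) : mk I Aᶜ = mk I Bᶜ := by
  rw [mk_eq_mk] at *
  rwa [compl_sdiff_compl, compl_sdiff_compl, and_comm]

theorem inter_congr {A B A' B' : Set α} (h : mk I A = mk I A') (k : mk I B = mk I B') :
    mk I (A ∩ B) = mk I (A' ∩ B') :=
  le_antisymm
    (mk_inter_le_of ((mk_mono Set.inter_subset_left).trans h.le)
      ((mk_mono Set.inter_subset_right).trans k.le))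
    (mk_inter_le_of ((mk_mono Set.inter_subset_left).trans h.ge)
      ((mk_mono Set.inter_subset_right).trans k.ge))

theorem union_congr {A B A' B' : Set α} (h : mk I A = mk I A') (k : mk I B = mk I B') :
    mk I (A ∪ B) = mk I (A' ∪ B') :=
  le_antisymm
    (mk_union_le_of (h.le.trans (mk_mono Set.subset_union_left))
      (k.le.trans (mk_mono Set.subset_union_right)))
    (mk_union_le_of (h.ge.trans (mk_mono Set.subset_union_left))
      (k.ge.trans (mk_mono Set.subset_union_right)))

/-- `𝒫(α)/I` is a Boolean algebra, the operations being induced by `∪`, `∩` and complement. -/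
instance instBooleanAlgebra : BooleanAlgebra (PowMod I) where
  sup := Quotient.lift₂ (fun A B => mk I (A ∪ B)) (fun _ _ _ _ h k =>
    union_congr (mk_eq_mk.2 h) (mk_eq_mk.2 k))
  inf := Quotient.lift₂ (fun A B => mk I (A ∩ B)) (fun _ _ _ _ h k =>
    inter_congr (mk_eq_mk.2 h) (mk_eq_mk.2 k))
  compl := Quotient.lift (fun A => mk I Aᶜ) (fun _ _ h => compl_congr (mk_eq_mk.2 h))
  top := mk I Set.univ
  bot := mk I ∅
  le_sup_left a b := by
    obtain ⟨A, rfl⟩ := mk_surjective a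
    obtain ⟨B, rfl⟩ := mk_surjective b
    exact mk_mono Set.subset_union_left
  le_sup_right a b := by
    obtain ⟨A, rfl⟩ := mk_surjective a
    obtain ⟨B, rfl⟩ := mk_surjective b
    exact mk_mono Set.subset_union_right
  sup_le a b c h k := by
    obtain ⟨A, rfl⟩ := mk_surjective a
    obtain ⟨B, rfl⟩ := mk_surjective b
    obtain ⟨C, rfl⟩ := mk_surjective c
    exact mk_union_le_of h k
  inf_le_left a b := by
    obtain ⟨A, rfl⟩ := mk_surjective a
    obtain ⟨B, rfl⟩ := mk_surjective b
    exact mk_mono Set.inter_subset_left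
  inf_le_right a b := by
    obtain ⟨A, rfl⟩ := mk_surjective a
    obtain ⟨B, rfl⟩ := mk_surjective b
    exact mk_mono Set.inter_subset_right
  le_inf a b c h k := by
    obtain ⟨A, rfl⟩ := mk_surjective a
    obtain ⟨B, rfl⟩ := mk_surjective b
    obtain ⟨C, rfl⟩ := mk_surjective c
    exact mk_inter_le_of h k
  le_sup_inf a b c := by
    obtain ⟨A, rfl⟩ := mk_surjective a
    obtain ⟨B, rfl⟩ := mk_surjective b
    obtain ⟨C, rfl⟩ := mk_surjective c
    exact mk_mono (Set.union_inter_distrib_left A B C).ge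
  le_top a := by
    obtain ⟨A, rfl⟩ := mk_surjective a
    exact mk_mono (Set.subset_univ A)
  bot_le a := by
    obtain ⟨A, rfl⟩ := mk_surjective a
    exact mk_mono (Set.empty_subset A)
  inf_compl_le_bot a := by
    obtain ⟨A, rfl⟩ := mk_surjective a
    exact mk_mono (Set.inter_compl_self A).le
  top_le_sup_compl a := by
    obtain ⟨A, rfl⟩ := mk_surjective a
    exact mk_mono (Set.union_compl_self A).ge

theorem mk_eq_bot {A : Set α} : mk I A = ⊥ ↔ A ∈ I := by
  rw [eq_bot_iff]
  change A \ ∅ ∈ I ↔ A ∈ I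
  rw [Set.sdiff_empty]

end PowMod

/-! ### Countable elementary submodels of `H(χ)` -/

/-- The relation symbols of the language of set theory: one binary symbol. -/
inductive SetTheoryRel : ℕ → Type
  | mem : SetTheoryRel 2

/-- The first-order language of set theory. -/
def setLanguage : FirstOrder.Language := ⟨fun _ => Empty, SetTheoryRel⟩

/-- `H(χ)`: the sets whose transitive closure has cardinality less than `χ`. Equivalently, the sets
included in some transitive set of cardinality less than `χ`. -/
def HSet (χ : Cardinal.{u}) : Set ZFSet.{u} :=
  {x | ∃ t : ZFSet.{u}, t.IsTransitive ∧ x ⊆ t ∧ t.card < χ}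

/-- The structure `(H(χ), ∈)`. -/
instance instStructureHSet (χ : Cardinal.{u}) : setLanguage.Structure (HSet χ) where
  funMap := fun f _ => nomatch f
  RelMap := fun {_} r => match r with
    | SetTheoryRel.mem => fun v => (v 0 : ZFSet.{u}) ∈ (v 1 : ZFSet.{u})

/-- `N` is (the underlying set of) a countable elementary submodel of `(H(χ), ∈)`. -/
def IsCountableElementarySubmodel (χ : Cardinal.{u}) (N : Set ZFSet.{u}) : Prop :=
  N.Countable ∧
    ∃ M : setLanguage.ElementarySubstructure (HSet χ), N = Subtype.val '' (M : Set (HSet χ))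

/-! ### Proper forcing notions -/

section Forcing

variable {P : Type u} [Preorder P]

/-- Two conditions are compatible if they have a common extension (smaller is stronger). -/
def ForcingCompatible (p q : P) : Prop := ∃ r, r ≤ p ∧ r ≤ q

/-- `D` is predense below `q`: every `r ≤ q` is compatible with a member of `D`. -/
def PredenseBelow (D : Set P) (q : P) : Prop := ∀ r ≤ q, ∃ d ∈ D, ForcingCompatible r d

/-- `D` is predense: every condition is compatible with a member of `D`. -/
def Predense (D : Set P) : Prop := ∀ r, ∃ d ∈ D, ForcingCompatible r d

/-- The set in the cumulative hierarchy that corresponds to `D ⊆ P`, where each `p : P` is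
identified with the set `e p`. -/
noncomputable def codeSubset (e : P ↪ ZFSet.{u}) (D : Set P) : ZFSet.{u} :=
  ZFSet.range fun d : D => e d

/-- The forcing notion `(P, ≤)` as a member of the cumulative hierarchy, where each `p : P` is
identified with the set `e p`: the ordered pair of the underlying set and the set of all
ordered pairs `(p, q)` with `p ≤ q`. -/
noncomputable def codeForcing (e : P ↪ ZFSet.{u}) : ZFSet.{u} :=
  ZFSet.pair (ZFSet.range e)
    (ZFSet.range fun x : {x : P × P // x.1 ≤ x.2} => ZFSet.pair (e x.1.1) (e x.1.2))

/-- `q` is `(N, P)`-generic: for every predense `D ⊆ P` with `D ∈ N`, the set `D ∩ N` is predense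
below `q`. -/
def IsGenericCondition (e : P ↪ ZFSet.{u}) (N : Set ZFSet.{u}) (q : P) : Prop :=
  ∀ D : Set P, Predense D → codeSubset e D ∈ N → PredenseBelow {d ∈ D | e d ∈ N} q

end Forcing

/-- The forcing notion `P` is proper: for all sufficiently large regular `χ`, if `N` is a countable
elementary submodel of `H(χ)` with `P ∈ N`, then every `p ∈ P ∩ N` has an `(N, P)`-generic
extension `q ≤ p`. For this, `P` is replaced by an isomorphic copy (given by `e`) in the
cumulative hierarchy; properness is invariant under isomorphism, so the choice of the copy is
immaterial. -/
def IsProperForcing (P : Type u) [Preorder P] : Prop :=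
  ∃ e : P ↪ ZFSet.{u}, ∃ χ₀ : Cardinal.{u}, ∀ χ : Cardinal.{u}, χ₀ ≤ χ → χ.IsRegular →
    ∀ N : Set ZFSet.{u}, IsCountableElementarySubmodel χ N → codeForcing e ∈ N →
      ∀ p : P, e p ∈ N → ∃ q ≤ p, IsGenericCondition e N q

/-- A Boolean algebra is proper if the forcing notion of its nonzero elements is. -/
def IsProperBooleanAlgebra (B : Type u) [BooleanAlgebra B] : Prop :=
  IsProperForcing {b : B // b ≠ ⊥}

/-! ### The Banach–Mazur game -/

section Game

variable {α : Type u}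

/-- `I` is `<κ`-complete: closed under unions of fewer than `κ` many members. -/
def IsCompleteIdeal (κ : Cardinal.{u}) (I : Order.Ideal (Set α)) : Prop :=
  ∀ F : Set (Set α), #F < κ → (∀ A ∈ F, A ∈ I) → ⋃₀ F ∈ I

/-- A strategy for empty maps the finite sequence `S 0, …, S (n-1)` of the previous moves of
nonempty to the move of empty at stage `n`. (The previous moves of empty are determined by the
strategy.) -/
def EmptyStrategy (α : Type u) : Type u := List (Set α) → Set α

/-- The move of empty at stage `n` when empty follows `τ` and nonempty plays `S 0, S 1, …`. -/
def EmptyStrategy.move (τ : EmptyStrategy α) (S : ℕ → Set α) (n : ℕ) : Set α :=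
  τ (List.ofFn fun i : Fin n => S i)

/-- The set `S (n-1)` below which empty has to move at stage `n`, where `S (-1)` is the whole
space. -/
def prevMove (S : ℕ → Set α) : ℕ → Set α
  | 0 => Set.univ
  | n + 1 => S n

/-- `Y` is a legal answer to the set `X`: an `I`-positive subset of `X`. -/
def LegalMove (I : Order.Ideal (Set α)) (X Y : Set α) : Prop := Y ∉ I ∧ Y ⊆ X

/-- `τ` is a winning strategy for empty in the game `BM_{∉I,∅}(I)`: as long as nonempty has obeyed
the rules, `τ` provides a legal move for empty, and in every run in which nonempty obeys
the rules and empty follows `τ`, the intersection of the sets `S n` is in `I`. -/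
def IsWinningForEmpty (I : Order.Ideal (Set α)) (τ : EmptyStrategy α) : Prop :=
  ∀ S : ℕ → Set α,
    (∀ n, (∀ m < n, LegalMove I (τ.move S m) (S m)) → LegalMove I (prevMove S n) (τ.move S n)) ∧
    ((∀ n, LegalMove I (τ.move S n) (S n)) → ⋂ n, S n ∈ I)

/-- `𝔞(BM_{∉I,∅}(I))`: empty has no winning strategy in the Banach–Mazur game in which empty moves
first and wins a run iff the intersection is in `I`. -/
def EmptyDoesNotWinBM (I : Order.Ideal (Set α)) : Prop :=
  ¬ ∃ τ : EmptyStrategy α, IsWinningForEmpty I τ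

end Game

/-! Suppose `τ` wins for empty. For each position and each class that `τ` can be made to play next,
fix one answer producing it; finite sequences of conditions then code positions. At a legal position
`σ`, the classes of possible next moves of `τ`, together with the conditions incompatible with `[τ
σ]`, are predense (`predense_nextClasses`). Properness, applied to a countable model closed under
the map from codes to these predense sets, gives a countable `C` and a condition `q = [Q]` below the
first move such that they stay predense below `q` when cut down to `C`
(`exists_countable_predenseBelow`).

Hence, at each of the countably many legal positions coded in `C`, almost every point of `Q ∩ τ σ`
lies in a next move coded in `C` (`sdiff_iUnion_mem_of_predenseBelow`). So almost every point of `Q`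
follows some branch in `C^ω`. There are at most `2^ℵ₀ < κ` branches, and the points following any
one of them lie in the intersection of a run won by empty, so form a set in `I` (`branchSet_mem`).
Completeness gives `Q ∈ I`, contradicting `q ≠ ⊥`. -/

/-! ### Countable elementary substructures closed under an operation on finite sequences -/

section Skolem

open FirstOrder Language

/-- The language with exactly one function symbol of each arity and no relation symbols. -/
def oneFunctionLanguage : FirstOrder.Language.{0, 0} := ⟨fun _ => Unit, fun _ => Empty⟩

/-- An operation on finite sequences interprets `oneFunctionLanguage`. -/
@[reducible]
def oneFunctionStructure {M : Type*} (F : List M → M) : oneFunctionLanguage.Structure M where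
  funMap := fun _ x => F (List.ofFn x)
  RelMap := fun r => nomatch r

/-- A form of the downward Löwenheim–Skolem theorem: the elementary substructure may be taken to
be closed under a given operation on finite sequences. -/
theorem exists_countable_elementarySubstructure_closed {L : FirstOrder.Language.{0, 0}}
    (hL : L.card ≤ ℵ₀) {M : Type*} [Nonempty M] [L.Structure M] {s : Set M} (hs : s.Countable)
    (F : List M → M) :
    ∃ S : L.ElementarySubstructure M, s ⊆ S ∧ (S : Set M).Countable ∧
      ∀ l : List M, (∀ x ∈ l, x ∈ S) → F l ∈ S := by
  let inst := oneFunctionStructure F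
  -- Closure under the Skolem functions gives elementarity; the extra symbols give closure under
  -- `F`. The combined language is still countable.
  let L' := (L.sum L.skolem₁).sum oneFunctionLanguage
  have h₁ : Countable (Σ n, (L.sum L.skolem₁).Functions n) :=
    Cardinal.mk_le_aleph0_iff.1 (card_functions_sum_skolem₁_le.trans (max_le le_rfl hL))
  have h₂ : Countable (Σ n, L'.Functions n) := by
    have h₃ : ∀ n, Countable ((L.sum L.skolem₁).Functions n) := fun n =>
      (sigma_mk_injective (i := n)).countable
    have h₄ : ∀ n, Countable (L'.Functions n) := fun n => by
      have : Countable (oneFunctionLanguage.Functions n) := inferInstanceAs (Countable Unit)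
      exact inferInstanceAs (Countable (_ ⊕ _))
    infer_instance
  let T : L'.Substructure M := Substructure.closure L' s
  have hT : Countable T := hs.substructure_closure L'
  refine ⟨Substructure.elementarySkolem₁Reduct (LHom.sumInl.substructureReduct T),
    Substructure.subset_closure (L := L') (s := s), Set.countable_coe_iff.1 hT, fun l hl => ?_⟩
  have h := T.fun_mem (LHom.sumInr.onFunction (() : oneFunctionLanguage.Functions l.length))
    l.get fun i => hl _ (List.get_mem l i)
  have h' : F (List.ofFn l.get) ∈ T := h
  rwa [List.ofFn_get] at h'

end Skolem

theorem setLanguage_card_le : setLanguage.card ≤ ℵ₀ := by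
  have h₁ : ∀ n, Countable (SetTheoryRel n) := fun n =>
    Function.Injective.countable (f := fun _ => ()) fun a b _ => by cases a; cases b; rfl
  have h₂ : ∀ n, Countable (setLanguage.Relations n) := h₁
  have h₃ : ∀ n, Countable (setLanguage.Functions n) := fun n =>
    inferInstanceAs (Countable Empty)
  exact Cardinal.mk_le_aleph0_iff.2
    (inferInstanceAs (Countable ((Σ n, setLanguage.Functions n) ⊕ Σ n, setLanguage.Relations n)))

/-! ### Properness -/

section Proper

variable {P : Type u} [Preorder P]

/-- Kuratowski pairs: the underlying set belongs to its singleton, which is a member of the code. -/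
theorem range_mem_of_codeForcing_subset {e : P ↪ ZFSet.{u}} {t : ZFSet.{u}}
    (ht : t.IsTransitive) (h : codeForcing e ⊆ t) : ZFSet.range e ∈ t :=
  ht.mem_trans (ZFSet.mem_singleton.2 rfl)
    (h (show ({ZFSet.range e} : ZFSet) ∈ codeForcing e from ZFSet.mem_pair.2 (Or.inl rfl)))

/-- For a proper forcing notion `P` and countably many subsets of `P` indexed by the finite
sequences in `P`, there are a countable `C ⊆ P` and `q ≤ p` such that those of the subsets with
indices in `C` that are predense remain predense below `q` when restricted to `C`. -/
theorem IsProperForcing.exists_countable_predenseBelow (hP : IsProperForcing P) (p : P)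
    (D : List P → Set P) :
    ∃ C : Set P, C.Countable ∧ ∃ q ≤ p, ∀ l : List P, (∀ x ∈ l, x ∈ C) → Predense (D l) →
      PredenseBelow {d ∈ D l | d ∈ C} q := by
  obtain ⟨e, χ₀, h⟩ := hP
  -- This one transitive set witnesses that the code of `P`, every condition and every subset of `P`
  -- lie in `H(χ)`.
  let t : ZFSet.{u} := ZFSet.vonNeumann (codeForcing e).rank
  have ht : t.IsTransitive := ZFSet.isTransitive_vonNeumann _
  have het : codeForcing e ⊆ t := ZFSet.subset_vonNeumann_self _
  have hr : ZFSet.range e ⊆ t :=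
    ht.subset_of_mem (range_mem_of_codeForcing_subset ht het)
  let χ : Cardinal.{u} := Order.succ (max (max χ₀ t.card) ℵ₀)
  have hχt : t.card < χ :=
    ((le_max_right _ _).trans (le_max_left _ _)).trans_lt (Order.lt_succ _)
  have hχ : χ₀ ≤ χ :=
    ((le_max_left _ _).trans (le_max_left _ _)).trans (Order.le_succ _)
  have hχreg : χ.IsRegular := Cardinal.isRegular_succ (le_max_right _ _)
  let a : HSet χ := ⟨codeForcing e, t, ht, het, hχt⟩
  let b : P → HSet χ := fun x =>
    ⟨e x, t, ht, ht.subset_of_mem (hr (ZFSet.mem_range_self x)), hχt⟩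
  have hb : Function.Injective b := fun x y hxy => e.injective (congrArg Subtype.val hxy)
  let c : Set P → HSet χ := fun E => ⟨codeSubset e E, t, ht, fun x hx => by
    obtain ⟨d, rfl⟩ := ZFSet.mem_range.1 hx
    exact hr (ZFSet.mem_range_self _), hχt⟩
  have : Nonempty P := ⟨p⟩
  have : Nonempty (HSet χ) := ⟨a⟩
  -- `D` is arbitrary, so elementarity alone need not put the sets `D l` into the model; it is
  -- closed under `D` by force. Values of `invFun` outside the range of `b` are junk and never used.
  obtain ⟨S, hsS, hS, hSF⟩ := exists_countable_elementarySubstructure_closed setLanguage_card_le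
    (s := {a, b p}) (Set.toFinite _).countable
    fun l : List (HSet χ) => c (D (l.map (Function.invFun b)))
  have hN : IsCountableElementarySubmodel χ (Subtype.val '' (S : Set (HSet χ))) :=
    ⟨hS.image _, S, rfl⟩
  have hbS : ∀ x, e x ∈ Subtype.val '' (S : Set (HSet χ)) ↔ b x ∈ S := fun x =>
    ⟨fun ⟨y, hy, hyx⟩ => (Subtype.ext hyx : y = b x) ▸ hy, fun hx => ⟨b x, hx, rfl⟩⟩
  obtain ⟨q, hqp, hq⟩ := h χ hχ hχreg _ hN ⟨a, hsS (by simp), rfl⟩ p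
    ((hbS p).2 (hsS (by simp)))
  refine ⟨b ⁻¹' S, hS.preimage hb, q, hqp, fun l hl hD => ?_⟩
  have hl' := hSF (l.map b) (by simpa using hl)
  rw [List.map_map, (Function.leftInverse_invFun hb).comp_eq_id, List.map_id] at hl'
  have hgen := hq (D l) hD ⟨_, hl', rfl⟩
  simp only [hbS] at hgen
  exact hgen

end Proper

/-! ### Ideals -/

theorem IsCompleteIdeal.iUnion_mem {α ι : Type u} {κ : Cardinal.{u}} {I : Order.Ideal (Set α)}
    (hI : IsCompleteIdeal κ I) (hι : #ι < κ) {A : ι → Set α} (hA : ∀ i, A i ∈ I) :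
    ⋃ i, A i ∈ I := by
  rw [← Set.sUnion_range]
  exact hI _ (Cardinal.mk_range_le.trans_lt hι) (by rintro _ ⟨i, rfl⟩; exact hA i)

/-! ### Runs of the game -/

section Run

variable {α : Type u} {I : Order.Ideal (Set α)} {τ : EmptyStrategy α}

/-- A finite sequence of moves of nonempty is legal against the strategy `τ` of empty. -/
inductive LegalPosition (I : Order.Ideal (Set α)) (τ : EmptyStrategy α) : List (Set α) → Prop
  | nil : LegalPosition I τ []
  | snoc {σ : List (Set α)} {S : Set α} (hσ : LegalPosition I τ σ) (hS : LegalMove I (τ σ) S) :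
      LegalPosition I τ (σ ++ [S])

/-- Winning is phrased for infinite sequences, so finite positions must be extended. The tail `f` is
arbitrary so that the induction can prescribe the next move as its first term. -/
theorem LegalPosition.exists_run {σ : List (Set α)} (hσ : LegalPosition I τ σ) (f : ℕ → Set α) :
    ∃ S : ℕ → Set α, (∀ m < σ.length, LegalMove I (τ.move S m) (S m)) ∧
      (List.ofFn fun i : Fin σ.length => S i) = σ ∧ ∀ m, S (σ.length + m) = f m := by
  induction hσ generalizing f with
  | nil => exact ⟨f, by simp, by simp, by simp⟩
  | @snoc σ T hσ hT ih =>
    obtain ⟨S, h₁, h₂, h₃⟩ := ih fun m => Nat.casesOn m T f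
    have hT' : S σ.length = T := h₃ 0
    refine ⟨S, fun m hm => ?_, ?_, fun m => ?_⟩
    · rw [List.length_append, List.length_singleton, Nat.lt_succ_iff] at hm
      rcases hm.lt_or_eq with hm | rfl
      · exact h₁ m hm
      · rw [EmptyStrategy.move, h₂, hT']
        exact hT
    · rw [List.length_append, List.length_singleton, List.ofFn_succ_last]
      simp only [Fin.val_castSucc, Fin.val_last]
      rw [h₂, hT']
    · rw [List.length_append, List.length_singleton, Nat.add_assoc, Nat.add_comm 1 m]
      exact h₃ (m + 1)

theorem IsWinningForEmpty.notMem (hτ : IsWinningForEmpty I τ) {σ : List (Set α)}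
    (hσ : LegalPosition I τ σ) : τ σ ∉ I := by
  obtain ⟨S, h₁, h₂, -⟩ := hσ.exists_run fun _ => ∅
  have h := (hτ S).1 σ.length h₁
  rw [EmptyStrategy.move, h₂] at h
  exact h.1

theorem IsWinningForEmpty.subset (hτ : IsWinningForEmpty I τ) {σ : List (Set α)} {T : Set α}
    (hσ : LegalPosition I τ σ) (hT : LegalMove I (τ σ) T) : τ (σ ++ [T]) ⊆ T := by
  obtain ⟨S, h₁, h₂, -⟩ := (hσ.snoc hT).exists_run fun _ => ∅
  have h := ((hτ S).1 _ h₁).2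
  rw [EmptyStrategy.move, h₂, List.length_append, List.length_singleton] at h
  rw [List.length_append, List.length_singleton, List.ofFn_succ_last] at h₂
  simp only [Fin.val_castSucc, Fin.val_last] at h₂
  have hT' : S σ.length = T := by simpa using (List.append_inj' h₂ rfl).2
  rwa [prevMove, hT'] at h

/-- The nonzero elements of `𝒫(α)/I`. -/
abbrev PosPowMod (I : Order.Ideal (Set α)) : Type u := {b : PowMod I // b ≠ ⊥}

/-- After the answer `S` to the position `σ`, the strategy `τ` plays a set in the class `d`. -/
def IsAnswerFor (I : Order.Ideal (Set α)) (τ : EmptyStrategy α) (σ : List (Set α))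
    (d : PosPowMod I) (S : Set α) : Prop :=
  LegalMove I (τ σ) S ∧ PowMod.mk I (τ (σ ++ [S])) = d

/-- A chosen answer to `σ` after which `τ` plays a set in the class `d`, if there is any. -/
noncomputable def answer (I : Order.Ideal (Set α)) (τ : EmptyStrategy α) (σ : List (Set α))
    (d : PosPowMod I) : Set α :=
  Classical.epsilon (IsAnswerFor I τ σ d)

/-- The position reached when nonempty makes the chosen answers for the classes in `l`. -/
noncomputable def positionOf (I : Order.Ideal (Set α)) (τ : EmptyStrategy α)
    (l : List (PosPowMod I)) : List (Set α) :=
  l.foldl (fun σ d => σ ++ [answer I τ σ d]) []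

theorem positionOf_append (l : List (PosPowMod I)) (d : PosPowMod I) :
    positionOf I τ (l ++ [d]) = positionOf I τ l ++ [answer I τ (positionOf I τ l) d] := by
  simp [positionOf]

/-- The classes of possible next moves of empty after `σ`, and those disjoint from `τ σ`. -/
def nextClasses (I : Order.Ideal (Set α)) (τ : EmptyStrategy α) (σ : List (Set α)) :
    Set (PosPowMod I) :=
  {d | IsAnswerFor I τ σ d (answer I τ σ d) ∨ PowMod.mk I (τ σ) ⊓ d = ⊥}

/-- If `r = [R]` meets `τ σ` positively, then `τ σ ∩ R` is a legal answer, and the reply of `τ` to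
it is a positive subset of `R`. -/
theorem IsWinningForEmpty.predense_nextClasses (hτ : IsWinningForEmpty I τ) {σ : List (Set α)}
    (hσ : LegalPosition I τ σ) : Predense (nextClasses I τ σ) := by
  intro r
  by_cases hr : PowMod.mk I (τ σ) ⊓ r = ⊥
  · exact ⟨r, Or.inr hr, r, le_rfl, le_rfl⟩
  · obtain ⟨R, hR⟩ := PowMod.mk_surjective r.1
    rw [← hR] at hr
    have hS : LegalMove I (τ σ) (τ σ ∩ R) :=
      ⟨fun h => hr (PowMod.mk_eq_bot.2 h), Set.inter_subset_left⟩
    let d : PosPowMod I := ⟨PowMod.mk I (τ (σ ++ [τ σ ∩ R])),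
      fun h => hτ.notMem (hσ.snoc hS) (PowMod.mk_eq_bot.1 h)⟩
    have hd : d ≤ r := by
      change PowMod.mk I _ ≤ r.1
      rw [← hR]
      exact PowMod.mk_mono ((hτ.subset hσ hS).trans Set.inter_subset_right)
    exact ⟨d, Or.inl (Classical.epsilon_spec (p := IsAnswerFor I τ σ d) ⟨_, hS, rfl⟩),
      d, hd, le_rfl⟩

/-- Below a condition `[Q]` below which the classes of next moves in `C` are predense, almost all
points of `Q ∩ τ σ` lie in one of the corresponding next moves of empty. -/
theorem sdiff_iUnion_mem_of_predenseBelow {σ : List (Set α)} {C : Set (PosPowMod I)}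
    {q : PosPowMod I} {Q : Set α} (hQ : PowMod.mk I Q = q)
    (h : PredenseBelow {d ∈ nextClasses I τ σ | d ∈ C} q) :
    (Q ∩ τ σ) \ ⋃ d ∈ {d ∈ C | IsAnswerFor I τ σ d (answer I τ σ d)},
      τ (σ ++ [answer I τ σ d]) ∈ I := by
  by_contra hpos
  set U := ⋃ d ∈ {d ∈ C | IsAnswerFor I τ σ d (answer I τ σ d)}, τ (σ ++ [answer I τ σ d])
  -- A positive remainder would be a condition below `q`, hence compatible with some `d ∈ C`. But
  -- `d` is the class of a set inside `U`, or is disjoint from `τ σ`; either way `w = ⊥`.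
  obtain ⟨d, ⟨hd, hdC⟩, w, hwr, hwd⟩ :=
    h ⟨PowMod.mk I ((Q ∩ τ σ) \ U), fun h => hpos (PowMod.mk_eq_bot.1 h)⟩ (by
      change PowMod.mk I _ ≤ q.1
      rw [← hQ]
      exact PowMod.mk_mono (Set.sdiff_subset.trans Set.inter_subset_left))
  have hwr' : w.1 ≤ PowMod.mk I ((Q ∩ τ σ) \ U) := hwr
  have hwd' : w.1 ≤ d.1 := hwd
  refine w.2 (le_bot_iff.1 ?_)
  rcases hd with hd | hd
  · rw [← hd.2] at hwd'
    refine (le_inf hwr' hwd').trans (le_of_eq ?_)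
    refine PowMod.mk_eq_bot.2 ?_
    rw [Set.disjoint_iff_inter_eq_empty.1 (Set.disjoint_of_subset_right
      (Set.subset_biUnion_of_mem (u := fun d => τ (σ ++ [answer I τ σ d]))
      (show d ∈ {d ∈ C | IsAnswerFor I τ σ d (answer I τ σ d)} from ⟨hdC, hd⟩))
      Set.disjoint_sdiff_left)]
    exact I.bot_mem
  · exact (le_inf (hwr'.trans (PowMod.mk_mono
      (Set.sdiff_subset.trans Set.inter_subset_right))) hwd').trans hd.le

/-- The set of points that follow the branch `s` through the tree of positions. -/
def branchSet (I : Order.Ideal (Set α)) (τ : EmptyStrategy α) (s : ℕ → PosPowMod I) : Set α :=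
  {x | ∀ n, let σ := positionOf I τ (List.ofFn fun i : Fin n => s i)
    IsAnswerFor I τ σ (s n) (answer I τ σ (s n)) ∧ x ∈ τ σ}

theorem positionOf_ofFn_succ (s : ℕ → PosPowMod I) (n : ℕ) :
    positionOf I τ (List.ofFn fun i : Fin (n + 1) => s i) =
      positionOf I τ (List.ofFn fun i : Fin n => s i) ++
        [answer I τ (positionOf I τ (List.ofFn fun i : Fin n => s i)) (s n)] := by
  rw [List.ofFn_succ_last]
  exact positionOf_append _ _

/-- Legality of the answers does not depend on the point, so a single point on the branch makes it a
genuine run. Each point lies in move `n + 1` of `τ`, which is contained in `S n`, hence in the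
intersection of the run. -/
theorem IsWinningForEmpty.branchSet_mem (hτ : IsWinningForEmpty I τ) (s : ℕ → PosPowMod I) :
    branchSet I τ s ∈ I := by
  rcases (branchSet I τ s).eq_empty_or_nonempty with he | ⟨x₀, hx₀⟩
  · rw [he]
    exact I.bot_mem
  let σ : ℕ → List (Set α) := fun n => positionOf I τ (List.ofFn fun i : Fin n => s i)
  let S : ℕ → Set α := fun n => answer I τ (σ n) (s n)
  have hσ : ∀ n, σ n = List.ofFn fun i : Fin n => S i := by
    intro n
    induction n with
    | zero => simp [σ, positionOf]
    | succ n ih =>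
      rw [List.ofFn_succ_last]
      simp only [Fin.val_castSucc, Fin.val_last]
      rw [← ih]
      exact positionOf_ofFn_succ s n
  have hleg : ∀ n, LegalMove I (τ.move S n) (S n) := by
    intro n
    rw [EmptyStrategy.move, ← hσ]
    exact (hx₀ n).1.1
  refine I.lower (fun x hx => Set.mem_iInter.2 fun n => ?_) ((hτ S).2 hleg)
  have h := ((hτ S).1 (n + 1) fun m _ => hleg m).2
  rw [EmptyStrategy.move, ← hσ] at h
  exact h (hx (n + 1)).2

end Run

/-! ### Covering the generic condition by branches -/

/-- A sequence can be built by dependent choice if every finite sequence that has been built so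
far can be prolonged. -/
theorem exists_seq_of_forall_list {β : Type*} (G : List β → Prop) (R : List β → β → Prop)
    (h₀ : G []) (h₁ : ∀ l, G l → ∃ b, R l b ∧ G (l ++ [b])) :
    ∃ s : ℕ → β, ∀ n, G (List.ofFn fun i : Fin n => s i) ∧
      R (List.ofFn fun i : Fin n => s i) (s n) := by
  choose f hf using h₁
  let step : {l // G l} → {l // G l} := fun l => ⟨l.1 ++ [f l.1 l.2], (hf l.1 l.2).2⟩
  let t : ℕ → {l // G l} := fun n => step^[n] ⟨[], h₀⟩
  have ht : ∀ n, t (n + 1) = step (t n) := fun n => Function.iterate_succ_apply' step n _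
  let s : ℕ → β := fun n => f (t n).1 (t n).2
  have hs : ∀ n, (List.ofFn fun i : Fin n => s i) = (t n).1 := by
    intro n
    induction n with
    | zero => rfl
    | succ n ih =>
      rw [List.ofFn_succ_last, ht]
      simp only [Fin.val_castSucc, Fin.val_last]
      rw [ih]
  refine ⟨s, fun n => ?_⟩
  rw [hs]
  exact ⟨(t n).2, (hf _ _).1⟩

theorem mainTheorem10 (κ : Cardinal.{u}) (hreg : κ.IsRegular) (hκ : 2 ^ ℵ₀ < κ)
    (I : Order.Ideal (Set κ.ord.ToType)) (hI : IsCompleteIdeal κ I)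
    (hproper : IsProperBooleanAlgebra (PowMod I)) :
    EmptyDoesNotWinBM I := by
  rintro ⟨τ, hτ⟩
  obtain ⟨C, hC, q, hq₀, hq⟩ := IsProperForcing.exists_countable_predenseBelow hproper
    ⟨PowMod.mk I (τ []), fun h => hτ.notMem .nil (PowMod.mk_eq_bot.1 h)⟩
    fun l => nextClasses I τ (positionOf I τ l)
  obtain ⟨Q, hQ⟩ := PowMod.mk_surjective q.1
  have hCle : #C ≤ ℵ₀ := Cardinal.mk_le_aleph0_iff.2 hC.to_subtype
  -- The points of `Q` outside a set in `I` follow a branch through positions given by `C`.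
  let U : List (PosPowMod I) → Set κ.ord.ToType := fun l =>
    ⋃ d ∈ {d ∈ C | IsAnswerFor I τ (positionOf I τ l) d (answer I τ (positionOf I τ l) d)},
      τ (positionOf I τ l ++ [answer I τ (positionOf I τ l) d])
  -- The points of `Q` that get stuck at the position coded by `l`. Legality is part of the
  -- definition, so codes of illegal positions contribute the empty set.
  let V : List C → Set κ.ord.ToType := fun l =>
    {x | LegalPosition I τ (positionOf I τ (l.map Subtype.val)) ∧
      x ∈ (Q ∩ τ (positionOf I τ (l.map Subtype.val))) \ U (l.map Subtype.val)}
  have hV : ⋃ l, V l ∈ I := by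
    have : Countable C := hC.to_subtype
    refine hI.iUnion_mem ((Cardinal.mk_le_aleph0_iff.2 inferInstance).trans_lt
      ((Cardinal.cantor ℵ₀).trans hκ)) fun l => ?_
    by_cases hl : LegalPosition I τ (positionOf I τ (l.map Subtype.val))
    · refine I.lower (fun x hx => hx.2) (sdiff_iUnion_mem_of_predenseBelow hQ
        (hq (l.map Subtype.val) (by simp +contextual) (hτ.predense_nextClasses hl)))
    · exact I.lower (fun x hx => hl hx.1) I.bot_mem
  -- There are at most `ℵ₀ ^ ℵ₀ = 2 ^ ℵ₀` branches through `C`.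
  have hB : ⋃ s : ℕ → C, branchSet I τ (fun n => (s n : PosPowMod I)) ∈ I := by
    refine hI.iUnion_mem (lt_of_le_of_lt ?_ hκ) fun s => hτ.branchSet_mem _
    rw [Cardinal.mk_arrow, Cardinal.mk_nat, Cardinal.lift_aleph0, Cardinal.lift_uzero,
      ← Cardinal.power_self_eq le_rfl]
    exact Cardinal.power_le_power_right hCle
  have hQ₀ : Q \ τ [] ∈ I := by
    have : q.1 ≤ PowMod.mk I (τ []) := hq₀
    rwa [← hQ, PowMod.mk_le_mk] at this
  refine q.2 (hQ ▸ PowMod.mk_eq_bot.2 (I.lower (fun x hx => ?_)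
    (I.sup_mem hQ₀ (I.sup_mem hV hB))))
  by_cases hx₀ : x ∈ τ []
  swap
  · exact Or.inl ⟨hx, hx₀⟩
  by_cases hxV : x ∈ ⋃ l, V l
  · exact Or.inr (Or.inl hxV)
  refine Or.inr (Or.inr ?_)
  -- A point of `Q ∩ τ []` that is never stuck can be followed forever, with all classes chosen in
  -- `C`.
  obtain ⟨s, hs⟩ := exists_seq_of_forall_list (β := C)
    (fun l => LegalPosition I τ (positionOf I τ (l.map Subtype.val)) ∧
      x ∈ τ (positionOf I τ (l.map Subtype.val)))
    (fun l d => IsAnswerFor I τ (positionOf I τ (l.map Subtype.val)) d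
      (answer I τ (positionOf I τ (l.map Subtype.val)) d)) ⟨.nil, hx₀⟩ (by
      rintro l ⟨hl, hxl⟩
      have hxU : x ∈ U (l.map Subtype.val) := by
        by_contra hxU
        exact hxV (Set.mem_iUnion.2 ⟨l, hl, ⟨hx, hxl⟩, hxU⟩)
      obtain ⟨d, ⟨hdC, hd⟩, hxd⟩ := Set.mem_iUnion₂.1 hxU
      refine ⟨⟨d, hdC⟩, hd, ?_⟩
      rw [List.map_append, List.map_singleton, positionOf_append]
      exact ⟨hl.snoc hd.1, hxd⟩)
  refine Set.mem_iUnion.2 ⟨s, fun n => ?_⟩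
  have h := hs n
  rw [List.map_ofFn] at h
  exact ⟨h.2, h.1.2⟩
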